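/- Let $\mathbb{K}$ be an infinite field with algebraic closure $\overline{\mathbb{K}}$, let $d \ge 1$ and $n_1,\dots,n_d \ge 0$ be integers, and let $f : \mathbb{K}^{n_1}\times\cdots\times\mathbb{K}^{n_d}\to\mathbb{K}$ be a $d$-linear form. For a set $S\subseteq \mathbb{K}^N$ of $\mathbb{K}$-rational points, let $\overline{S}\subseteq\overline{\mathbb{K}}^N$ denote the set of common zeros in $\overline{\mathbb{K}}^N$ of all polynomials in $\mathbb{K}[x_1,\dots,x_N]$ that vanish on $S$. For an algebraic set $Z\subseteq\overline{\mathbb{K}}^N$, put $\operatorname{codim} Z = N-\dim Z$, where $\dim Z$ is the Krull dimension of its coordinate ring, and $\operatorname{codim}\varnothing=\infty$. For a multilinear map $F:\mathbb{K}^{m_1}\times\cdots\times\mathbb{K}^{m_s}\to\mathbb{K}^m$, put $$Z_F(\mathbb{K})=\{(v_1,\dots,v_s)\in\mathbb{K}^{m_1}\times\cdots\times\mathbb{K}^{m_s} : F(v_1,\dots,v_s)=0\}.$$ For $j\in\{1,\dots,d\}$, let $$F_{f,j}:\mathbb{K}^{n_1}\times\cdots\times\mathbb{K}^{n_{j-1}}\times\mathbb{K}^{n_{j+1}}\times\cdots\times\mathbb{K}^{n_d}\to\mathbb{K}^{n_j}$$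 be the multilinear map determined by $f$, that is, the one whose $k$-th coordinate is obtained from $f$ by putting the $k$-th standard basis vector in slot $j$. The analytic rank of $f$ is defined with the last slot as output: $\operatorname{AR}_{\mathbb{K}}(f)=\operatorname{codim}\overline{Z_{F_{f,d}}(\mathbb{K})}$. Then, for every $j\in\{1,\dots,d\}$, $$\operatorname{AR}_{\mathbb{K}}(f)=\operatorname{codim}\overline{Z_{F_{f,j}}(\mathbb{K})}.$$ In other words, the analytic rank does not depend on which slot is chosen as output. -/

import Mathlib

noncomputable section

namespace MultilinearVariety

/-- The Zariski closure, in `σ`-dimensional affine space over the algebraic closure of `K`, of a set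
`S` of `K`-rational points: the common zeros in `AlgebraicClosure K` of all polynomials with
coefficients in `K` that vanish on `S`. -/
def zariskiClosure {K σ : Type*} [Field K] (S : Set (σ → K)) : Set (σ → AlgebraicClosure K) :=
  MvPolynomial.zeroLocus (AlgebraicClosure K) (MvPolynomial.vanishingIdeal K S)

/-- The dimension of an algebraic subset `Z` of affine space over a field `L`: the Krull dimension of
its coordinate ring `L[x] / I(Z)`. It is `⊥` (that is, `-∞`) exactly for `Z = ∅`. -/
def dim {L σ : Type*} [Field L] (Z : Set (σ → L)) : WithBot ℕ∞ :=
  ringKrullDim (MvPolynomial σ L ⧸ MvPolynomial.vanishingIdeal L Z)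

/-- The codimension of an algebraic subset `Z` of the affine space `L ^ σ`: the dimension `#σ` of the
affine space minus the dimension of `Z`, with the convention that the empty set has codimension `⊤`
(that is, `∞`). -/
def codim {L σ : Type*} [Field L] [Fintype σ] (Z : Set (σ → L)) : ℕ∞ :=
  WithBot.recBotCoe ⊤ (fun e : ℕ∞ => (Fintype.card σ : ℕ∞) - e) (dim Z)

/-- The set of `K`-rational points `Z_F(K)` of the multilinear variety of a multilinear map
`F : K^{n_1} × ⋯ × K^{n_d} → K^m`. A point of the product is given by all of its coordinates, which
are indexed by `Σ i, Fin (n i)`. -/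
def rationalPoints {K : Type*} [Field K] {d m : ℕ} {n : Fin d → ℕ}
    (F : MultilinearMap K (fun i : Fin d => Fin (n i) → K) (Fin m → K)) :
    Set ((Σ i : Fin d, Fin (n i)) → K) :=
  {v | F (fun i k => v ⟨i, k⟩) = 0}

/-- The multilinear map `F_{f,j}` into `K^{n_j}` that a multilinear form `f` determines by moving
slot `j` to the output: coordinate `k` of `F_{f,j}` is `f` with the `k`-th standard basis vector in
slot `j`. -/
def slice {K : Type*} [Field K] {d : ℕ} {n : Fin (d + 1) → ℕ}
    (f : MultilinearMap K (fun i : Fin (d + 1) => Fin (n i) → K) K) (j : Fin (d + 1)) :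
    MultilinearMap K (fun i : Fin d => Fin (n (j.succAbove i)) → K) (Fin (n j) → K) :=
  MultilinearMap.pi fun k : Fin (n j) => f.curryMid j (Pi.single k 1)

/-- `F_{f,j}` corresponds to `f` under pairing the output with slot `j`. -/
theorem slice_spec {K : Type*} [Field K] {d : ℕ} {n : Fin (d + 1) → ℕ}
    (f : MultilinearMap K (fun i : Fin (d + 1) => Fin (n i) → K) K) (j : Fin (d + 1))
    (x : Fin (n j) → K) (v : ∀ i : Fin d, Fin (n (j.succAbove i)) → K) :
    f (j.insertNth x v) = ∑ k, x k * slice f j v k := by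
  have h : f.curryMid j x = ∑ k, x k • f.curryMid j (Pi.single k 1) := by
    conv_lhs => rw [pi_eq_sum_univ' x]
    rw [map_sum]
    refine Finset.sum_congr rfl fun k _ => ?_
    rw [map_smul]
  calc f (j.insertNth x v) = f.curryMid j x v := rfl
    _ = ∑ k, x k * slice f j v k := by rw [h]; simp [slice]

/-- The analytic rank of a `(d + 1)`-linear form `f`: the codimension of the Zariski closure of
`Z_{F_f}(K)`, where `F_f` is `f` viewed as a multilinear map of the first `d` slots with values in
the last space. -/
def analyticRank {K : Type*} [Field K] {d : ℕ} {n : Fin (d + 1) → ℕ}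
    (f : MultilinearMap K (fun i : Fin (d + 1) => Fin (n i) → K) K) : ℕ∞ :=
  codim (zariskiClosure (rationalPoints (slice f (Fin.last d))))

end MultilinearVariety

end

namespace MultilinearVariety

open MvPolynomial
open scoped Matrix

/-! ### Krull dimension of finitely generated algebras. -/

section KrullDimension

/-! Restoring the omitted slot `j` as a free factor turns the zero set of the slice into
`degenerateLocus f j`, inside one space common to all `j`; this adds `n j` to the dimension and to
the ambient dimension alike (`pointDim_degenerateLocus`). It remains to compare these loci for two
slots `i ≠ j`. With the other slots fixed, `f` is a bilinear form with matrix `A`. One locus asks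
that `A y = 0` with `x` free, the other that `x A = 0` with `y` free, and both fibres have dimension
`n i + n j - rank A`. Fibre dimensions do not control closures of sets of rational points, so the
comparison is made by polynomial maps over `K`. For each choice of a minor, `exists_kernel_exchange`
gives one polynomial map under which the image of one locus contains the piece of the other where
that minor is nonzero and its columns span. Finitely many pieces suffice, and polynomial images do
not raise dimension (`pointDim_image_le`). -/

theorem ringKrullDim_le_of_isIntegral (R S : Type*) [CommRing R] [CommRing S] [Algebra R S]
    [Algebra.IsIntegral R S] : ringKrullDim S ≤ ringKrullDim R :=
  Order.krullDim_le_of_strictMono (PrimeSpectrum.comap (algebraMap R S))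
    fun _ _ h ↦ Ideal.IsIntegral.comap_lt_comap h

/-- Lying over lifts the bottom prime of a chain and going up lifts the rest. -/
theorem ringKrullDim_le_of_isIntegral_of_injective {R S : Type*} [CommRing R] [CommRing S]
    [Algebra R S] [Algebra.IsIntegral R S] (h : Function.Injective (algebraMap R S)) :
    ringKrullDim R ≤ ringKrullDim S := by
  refine iSup_le fun l ↦ ?_
  obtain ⟨P, -, hP, hl⟩ := Ideal.exists_ideal_over_prime_of_isIntegral (S := S) l.head.asIdeal ⊥ <| by
    rw [Ideal.comap_bot_of_injective _ h]
    exact bot_le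
  have : P.LiesOver l.head.asIdeal := ⟨hl.symm⟩
  obtain ⟨L, hL, -⟩ := Ideal.exists_ltSeries_of_hasGoingUp l P
  rw [← hL]
  exact Order.LTSeries.length_le_krullDim L

theorem ringKrullDim_eq_of_isIntegral_of_injective {R S : Type*} [CommRing R] [CommRing S]
    (f : R →+* S) (hf : f.IsIntegral) (h : Function.Injective f) :
    ringKrullDim R = ringKrullDim S := by
  algebraize [f]
  exact le_antisymm (ringKrullDim_le_of_isIntegral_of_injective h) (ringKrullDim_le_of_isIntegral R S)

theorem ringKrullDim_mvPolynomial_field (K : Type*) [Field K] (s : ℕ) :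
    ringKrullDim (MvPolynomial (Fin s) K) = s := by
  rw [MvPolynomial.ringKrullDim_of_isNoetherianRing, ringKrullDim_eq_zero_of_field]
  simp

/-- By Noether normalization the dimension is the size of a transcendence basis, which bounds every
algebraically independent family. -/
theorem le_ringKrullDim_of_injective_of_isDomain {K B : Type*} [Field K] [CommRing B]
    [IsDomain B] [Algebra K B] [Algebra.FiniteType K B] {s : ℕ}
    (f : MvPolynomial (Fin s) K →ₐ[K] B) (hf : Function.Injective f) : s ≤ ringKrullDim B := by
  obtain ⟨t, g, hg, hgi⟩ := exists_integral_inj_algHom_of_fg K B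
  rw [← ringKrullDim_eq_of_isIntegral_of_injective g.toRingHom hgi hg,
    ringKrullDim_mvPolynomial_field]
  have h1 : (AlgebraicIndependent K (f ∘ X)) :=
    (MvPolynomial.algebraicIndependent_X _ _).map' hf
  have h2 : IsTranscendenceBasis K (g ∘ X) := by
    have hi : AlgebraicIndependent K (g ∘ X) := (MvPolynomial.algebraicIndependent_X _ _).map' hg
    rw [hi.isTranscendenceBasis_iff_isAlgebraic]
    have hr : Algebra.adjoin K (Set.range (g ∘ X)) = g.range := by
      rw [Set.range_comp, ← AlgHom.map_adjoin, MvPolynomial.adjoin_range_X, Algebra.map_top]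
    rw [hr]
    refine ⟨fun b ↦ IsIntegral.isAlgebraic ?_⟩
    obtain ⟨p, hp, hpb⟩ := hgi b
    refine ⟨p.map g.rangeRestrict.toRingHom, hp.map _, ?_⟩
    rw [Polynomial.eval₂_map]
    exact hpb
  have h3 := h1.lift_cardinalMk_le_trdeg
  rw [← h2.lift_cardinalMk_eq_trdeg] at h3
  simp at h3
  exact_mod_cast h3

/-- The zero ideal of the polynomial ring is the contraction of some prime of `B`; dividing by that
prime keeps the map injective and reduces to a domain. -/
theorem le_ringKrullDim_of_injective {K B : Type*} [Field K] [CommRing B]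
    [Algebra K B] [Algebra.FiniteType K B] {s : ℕ}
    (f : MvPolynomial (Fin s) K →ₐ[K] B) (hf : Function.Injective f) : s ≤ ringKrullDim B := by
  obtain ⟨p, hp, hpf⟩ := Ideal.exists_comap_eq_of_mem_minimalPrimes_of_injective
    (f := f.toRingHom) hf ⊥ (by simp [IsDomain.minimalPrimes_eq_singleton_bot])
  refine (le_ringKrullDim_of_injective_of_isDomain ((Ideal.Quotient.mkₐ K p).comp f) ?_).trans
    (ringKrullDim_quotient_le p)
  rw [injective_iff_map_eq_zero]
  intro a ha
  have : a ∈ Ideal.comap f.toRingHom p :=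
    (Ideal.Quotient.eq_zero_iff_mem (I := p) (a := f a)).mp ha
  rwa [hpf] at this

theorem ringKrullDim_le_of_injective {K A B : Type*} [Field K] [CommRing A] [CommRing B]
    [Algebra K A] [Algebra K B] [Algebra.FiniteType K A] [Algebra.FiniteType K B]
    (f : A →ₐ[K] B) (hf : Function.Injective f) : ringKrullDim A ≤ ringKrullDim B := by
  cases subsingleton_or_nontrivial A
  · simp [ringKrullDim_eq_bot_of_subsingleton]
  obtain ⟨s, g, hg, hgi⟩ := exists_integral_inj_algHom_of_fg K A
  rw [← ringKrullDim_eq_of_isIntegral_of_injective g.toRingHom hgi hg,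
    ringKrullDim_mvPolynomial_field]
  exact le_ringKrullDim_of_injective (f.comp g) (hf.comp hg)

/-- A finite intersection of ideals has a quotient of dimension at most the largest dimension of
the individual quotients. -/
theorem ringKrullDim_quotient_iInf_le {R ι : Type*} [CommRing R] [Finite ι] (I : ι → Ideal R)
    {c : WithBot ℕ∞} (h : ∀ i, ringKrullDim (R ⧸ I i) ≤ c) : ringKrullDim (R ⧸ ⨅ i, I i) ≤ c := by
  rw [ringKrullDim_quotient]
  refine iSup_le fun l ↦ ?_
  have := Fintype.ofFinite ι
  obtain ⟨i, -, hi⟩ := (Ideal.IsPrime.inf_le' (s := Finset.univ) (f := I)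
    l.head.1.isPrime).mp (by
      rw [Finset.inf_univ_eq_iInf]
      exact l.head.2)
  refine le_trans ?_ (h i)
  rw [ringKrullDim_quotient]
  refine le_sSup ⟨⟨l.length, fun k ↦ ⟨(l k).1, hi.trans ?_⟩, fun k ↦ l.step k⟩, rfl⟩
  exact LTSeries.head_le l k

end KrullDimension

/-! ### Dimension of sets of rational points. -/

section PointSets

variable {K σ τ : Type*} [Field K]

/-- The Krull dimension of the ring of polynomial functions on a set of rational points. -/
noncomputable def pointDim (S : Set (σ → K)) : WithBot ℕ∞ :=
  ringKrullDim (MvPolynomial σ K ⧸ vanishingIdeal K S)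

/-- The coordinate ring over the algebraic closure is an integral extension of the one over `K`.
Injectivity holds because the closure contains the points of `S`. -/
theorem dim_zariskiClosure (S : Set (σ → K)) : dim (zariskiClosure S) = pointDim S := by
  symm
  have hle : vanishingIdeal K S ≤ (vanishingIdeal (AlgebraicClosure K) (zariskiClosure S)).comap
      (map (algebraMap K (AlgebraicClosure K))) := by
    intro p hp x hx
    have := hx p hp
    simpa [aeval_map_algebraMap] using this
  have hge : (vanishingIdeal (AlgebraicClosure K) (zariskiClosure S)).comap
      (map (algebraMap K (AlgebraicClosure K))) ≤
      vanishingIdeal K S := by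
    intro p hp x hx
    have hx' : (fun i ↦ algebraMap K (AlgebraicClosure K) (x i)) ∈ zariskiClosure S := by
      intro q hq
      have := hq x hx
      rw [show (fun i ↦ algebraMap K (AlgebraicClosure K) (x i)) =
        algebraMap K (AlgebraicClosure K) ∘ x from rfl, MvPolynomial.aeval_algebraMap_apply]
      simp [this]
    have := hp _ hx'
    rw [aeval_map_algebraMap,
      show (fun i ↦ algebraMap K (AlgebraicClosure K) (x i)) =
        algebraMap K (AlgebraicClosure K) ∘ x from rfl, MvPolynomial.aeval_algebraMap_apply] at this
    simpa using this
  refine ringKrullDim_eq_of_isIntegral_of_injective (Ideal.quotientMap _ _ hle) ?_ ?_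
  · have h1 : (map (algebraMap K (AlgebraicClosure K))).IsIntegral :=
      letI := MvPolynomial.algebraMvPolynomial (σ := σ) (R := K) (S := AlgebraicClosure K)
      Algebra.IsIntegral.isIntegral (R := MvPolynomial σ K)
    refine RingHom.IsIntegral.tower_top (Ideal.Quotient.mk (vanishingIdeal K S)) _ ?_
    rw [Ideal.quotientMap_comp_mk]
    exact h1.trans _ _ (RingHom.isIntegral_of_surjective _ Ideal.Quotient.mk_surjective)
  · exact Ideal.quotientMap_injective' hge

theorem pointDim_mono {S T : Set (σ → K)} (h : S ⊆ T) : pointDim S ≤ pointDim T :=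
  ringKrullDim_le_of_surjective
    (Ideal.Quotient.factor (vanishingIdeal_anti_mono h)) (Ideal.Quotient.factor_surjective _)

theorem pointDim_iUnion_le {ι : Type*} [Finite ι] {S : ι → Set (σ → K)} {c : WithBot ℕ∞}
    (h : ∀ i, pointDim (S i) ≤ c) : pointDim (⋃ i, S i) ≤ c := by
  have : vanishingIdeal K (⋃ i, S i) = ⨅ i, vanishingIdeal K (S i) := by
    ext p
    simp only [mem_vanishingIdeal_iff, Set.mem_iUnion, Submodule.mem_iInf]
    grind
  unfold pointDim
  rw [this]
  exact ringKrullDim_quotient_iInf_le _ h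

/-- A polynomial map does not increase the dimension. -/
theorem pointDim_image_le [Finite σ] [Finite τ] (φ : σ → MvPolynomial τ K) (S : Set (τ → K)) :
    pointDim ((fun x i ↦ eval x (φ i)) '' S) ≤ pointDim S := by
  have key : ∀ p : MvPolynomial σ K, ∀ x : τ → K,
      aeval x (aeval φ p) = aeval (fun i ↦ eval x (φ i)) p := by
    intro p x
    rw [← AlgHom.comp_apply, comp_aeval]
    simp [aeval_eq_eval]
  -- The vanishing ideal of the image is a contraction, so pullback of functions embeds one
  -- coordinate ring in the other.
  have hc : vanishingIdeal K ((fun x i ↦ eval x (φ i)) '' S) =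
      (vanishingIdeal K S).comap (aeval φ : MvPolynomial σ K →ₐ[K] MvPolynomial τ K) := by
    ext p
    simp only [mem_vanishingIdeal_iff, Set.forall_mem_image, Ideal.mem_comap, key]
  exact ringKrullDim_le_of_injective (K := K) (Ideal.quotientMapₐ _ (aeval φ) hc.le)
    (Ideal.quotientMap_injective' (H := hc.le) hc.ge)

/-- The coordinate ring of the product is a polynomial ring in the `τ`-variables over that of `S`.
This uses that a polynomial vanishing at all points over an infinite field is zero. -/
theorem pointDim_prod_univ [Infinite K] [Finite σ] [Finite τ] (S : Set (σ → K)) :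
    pointDim {x : τ ⊕ σ → K | x ∘ Sum.inr ∈ S} = pointDim S + Nat.card τ := by
  unfold pointDim
  rw [← MvPolynomial.ringKrullDim_of_isNoetherianRing]
  let f : MvPolynomial (τ ⊕ σ) K →+* MvPolynomial τ (MvPolynomial σ K ⧸ vanishingIdeal K S) :=
    (MvPolynomial.map (Ideal.Quotient.mk _)).comp (sumRingEquiv K τ σ).toRingHom
  have hf : Function.Surjective f :=
    (MvPolynomial.map_surjective _ Ideal.Quotient.mk_surjective).comp (sumRingEquiv K τ σ).surjective
  have key : ∀ (p : MvPolynomial (τ ⊕ σ) K) (x : τ ⊕ σ → K), eval x p =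
      eval (x ∘ Sum.inl) (map (eval (x ∘ Sum.inr)) (sumRingEquiv K τ σ p)) := by
    intro p x
    induction p using MvPolynomial.induction_on with
    | C a => simp
    | add p q hp hq => simp [hp, hq]
    | mul_X p i hp => cases i <;> simp [hp]
  have hk : RingHom.ker f = vanishingIdeal K {x : τ ⊕ σ → K | x ∘ Sum.inr ∈ S} := by
    ext p
    simp only [RingHom.mem_ker, mem_vanishingIdeal_iff, aeval_eq_eval]
    have : f p = 0 ↔ ∀ y ∈ S, map (eval y) (sumRingEquiv K τ σ p) = 0 := by
      simp only [f, RingHom.comp_apply, MvPolynomial.ext_iff, coeff_map, coeff_zero]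
      simp only [Ideal.Quotient.eq_zero_iff_mem, mem_vanishingIdeal_iff, aeval_eq_eval]
      exact ⟨fun h y hy m ↦ h m y hy, fun h m y hy ↦ h y hy m⟩
    rw [this]
    constructor
    · intro h x hx
      have := key p x
      simpa [h _ hx] using this
    · intro h y hy
      refine MvPolynomial.funext fun z ↦ ?_
      have := key p (Sum.elim z y)
      simp only [Sum.elim_comp_inl, Sum.elim_comp_inr] at this
      rw [← this, map_zero]
      exact h _ (by simpa using hy)
  rw [← hk]
  exact ringKrullDim_eq_of_ringEquiv (RingHom.quotientKerEquivOfSurjective hf)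

end PointSets

/-! ### Minors and exchange of left and right kernels. -/

section Minors

variable {K m n : Type*} [Field K] [Fintype m] [Fintype n]

/-- Some maximal nonzero minor of a matrix involves columns that span the column space. -/
theorem exists_submatrix_det_ne_zero (A : Matrix m n K) :
    ∃ r < Fintype.card n + 1, ∃ (I : Fin r → m) (J : Fin r → n), (A.submatrix I J).det ≠ 0 ∧
      ∀ x : m → K, x ᵥ* A.submatrix id J = 0 → x ᵥ* A = 0 := by
  classical
  obtain ⟨κ, J₀, hJ₀, hJspan, hJli⟩ := exists_linearIndependent' K A.col
  have := Fintype.ofInjective J₀ hJ₀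
  let e := Fintype.equivFin κ
  let B : Matrix m (Fin (Fintype.card κ)) K := A.submatrix id (J₀ ∘ e.symm)
  have hBli : LinearIndependent K B.col := hJli.comp e.symm e.symm.injective
  obtain ⟨ι, I₀, hI₀, hIspan, hIli⟩ := exists_linearIndependent' K B.row
  have := Fintype.ofInjective I₀ hI₀
  -- Row rank equals column rank, so the chosen rows and columns form a square block.
  have hcard : Fintype.card ι = Fintype.card κ := by
    rw [← finrank_span_eq_card hIli, hIspan, ← Matrix.rank_eq_finrank_span_row,
      Matrix.rank_eq_finrank_span_cols, finrank_span_eq_card hBli, Fintype.card_fin]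
  let e' := Fintype.equivFinOfCardEq hcard
  refine ⟨Fintype.card κ, Nat.lt_succ_of_le (Fintype.card_le_of_injective _ hJ₀),
    I₀ ∘ e'.symm, J₀ ∘ e.symm, ?_, fun x hx ↦ ?_⟩
  · have : LinearIndependent K (B.submatrix (I₀ ∘ e'.symm) id).row :=
      hIli.comp e'.symm e'.symm.injective
    rw [Matrix.linearIndependent_rows_iff_isUnit, Matrix.isUnit_iff_isUnit_det] at this
    exact this.ne_zero
  · have hker : Submodule.span K (Set.range A.col) ≤ LinearMap.ker (dotProductBilin K K x) := by
      rw [← hJspan, Submodule.span_le]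
      rintro _ ⟨k, rfl⟩
      change x ⬝ᵥ A.col (J₀ k) = 0
      rw [← e.symm_apply_apply k]
      exact congrFun hx (e k)
    funext l
    exact hker (Submodule.subset_span ⟨l, rfl⟩)

/-- If the minor of `A` in the rows `I` and columns `J` is nonzero and the columns `J` span the
column space of `A`, then every pair of a vector and a kernel vector of `A` arises from a pair of a
kernel vector of `Aᵀ` and a vector by a map that is polynomial in the entries of `A`. -/
theorem exists_kernel_exchange [DecidableEq m] [DecidableEq n] (A : Matrix m n K) {r : ℕ}
    (I : Fin r → m) (J : Fin r → n)
    (hdet : (A.submatrix I J).det ≠ 0)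
    (hJ : ∀ x : m → K, x ᵥ* A.submatrix id J = 0 → x ᵥ* A = 0) (x' : m → K) (y : n → K)
    (hy : A *ᵥ y = 0) :
    ∃ (x : m → K) (y' : n → K), x ᵥ* A = 0 ∧
      x' = x + (1 : Matrix m m K).submatrix id I *ᵥ (A.submatrix I id *ᵥ y') ∧
      y = (A.submatrix I J).det • y' - (1 : Matrix n n K).submatrix id J *ᵥ
        ((A.submatrix I J).adjugate *ᵥ (A.submatrix I id *ᵥ y')) := by
  set M := A.submatrix I J with hM
  have hu : IsUnit M.det := hdet.isUnit
  -- Subtracting `w` from the `I`-coordinates of `x'` kills its products with the columns `J`. The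
  -- vector `y'` is chosen so that `A.submatrix I id *ᵥ y' = w`, which lets `y'` remember `w`; the
  -- factor `det` clears the denominator of `M⁻¹`.
  let w := (x' ᵥ* A.submatrix id J) ᵥ* M⁻¹
  have hA : A.submatrix I id *ᵥ y = 0 := by
    funext i
    exact congrFun hy (I i)
  have hMJ : A.submatrix I id * (1 : Matrix n n K).submatrix id J = M := by
    ext a b
    simp [Matrix.mul_apply, Matrix.one_apply, hM]
  have hMI : ((1 : Matrix m m K).submatrix id I)ᵀ * A.submatrix id J = M := by
    ext a b
    simp [Matrix.mul_apply, Matrix.one_apply, hM]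
  have hw : A.submatrix I id *ᵥ (M.det⁻¹ • y + (1 : Matrix n n K).submatrix id J *ᵥ (M⁻¹ *ᵥ w)) =
      w := by
    rw [Matrix.mulVec_add, Matrix.mulVec_smul, hA, Matrix.mulVec_mulVec, hMJ, Matrix.mulVec_mulVec,
      Matrix.mul_nonsing_inv _ hu]
    simp
  refine ⟨x' - (1 : Matrix m m K).submatrix id I *ᵥ w,
    M.det⁻¹ • y + (1 : Matrix n n K).submatrix id J *ᵥ (M⁻¹ *ᵥ w), hJ _ ?_, ?_, ?_⟩
  · rw [Matrix.sub_vecMul, ← Matrix.vecMul_transpose, Matrix.vecMul_vecMul, hMI,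
      Matrix.vecMul_vecMul, Matrix.nonsing_inv_mul _ hu]
    simp
  · rw [hw]
    simp
  · rw [hw, smul_add, smul_smul, mul_inv_cancel₀ hdet, one_smul, ← Matrix.mulVec_smul,
      ← Matrix.smul_mulVec, Matrix.inv_def, smul_smul, Ring.inverse_eq_inv', mul_inv_cancel₀ hdet,
      one_smul, add_sub_cancel_right]

end Minors

/-! ### Comparison of the degenerate loci of two slots. -/

section Slots

variable {K ι : Type*} [Field K] [DecidableEq ι] {n : ι → ℕ}

/-- The matrix, indexed by the slots `i` and `j`, of the bilinear form that a multilinear form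
induces on these two slots when the other slots are fixed. -/
def slotMatrix (f : MultilinearMap K (fun i : ι => Fin (n i) → K) K) (i j : ι)
    (v : ∀ i, Fin (n i) → K) : Matrix (Fin (n i)) (Fin (n j)) K :=
  fun k l ↦ f (Function.update (Function.update v i (Pi.single k 1)) j (Pi.single l 1))

/-- The points at which a multilinear form vanishes identically as a function of slot `j`. -/
def degenerateLocus (f : MultilinearMap K (fun i : ι => Fin (n i) → K) K) (j : ι) :
    Set ((Σ i, Fin (n i)) → K) :=
  {w | ∀ k, f (Function.update (fun i k ↦ w ⟨i, k⟩) j (Pi.single k 1)) = 0}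

theorem map_update_eq_sum (f : MultilinearMap K (fun i : ι => Fin (n i) → K) K)
    (v : ∀ i, Fin (n i) → K) (j : ι) (y : Fin (n j) → K) :
    f (Function.update v j y) = ∑ k, y k * f (Function.update v j (Pi.single k 1)) := by
  change f.toLinearMap v j y = ∑ k, y k * f.toLinearMap v j (Pi.single k 1)
  conv_lhs => rw [pi_eq_sum_univ' y]
  simp

theorem slotMatrix_mulVec (f : MultilinearMap K (fun i : ι => Fin (n i) → K) K) {i j : ι}
    (hij : i ≠ j) (v : ∀ i, Fin (n i) → K) (k : Fin (n i)) :
    (slotMatrix f i j v *ᵥ v j) k = f (Function.update v i (Pi.single k 1)) := by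
  have : Function.update v i (Pi.single k 1) =
      Function.update (Function.update v i (Pi.single k 1)) j (v j) := by
    rw [eq_comm, Function.update_eq_self_iff, Function.update_of_ne hij.symm]
  rw [this, map_update_eq_sum]
  simp [Matrix.mulVec, dotProduct, slotMatrix, mul_comm]

theorem vecMul_slotMatrix (f : MultilinearMap K (fun i : ι => Fin (n i) → K) K) {i j : ι}
    (hij : i ≠ j) (v : ∀ i, Fin (n i) → K) (l : Fin (n j)) :
    (v i ᵥ* slotMatrix f i j v) l = f (Function.update v j (Pi.single l 1)) := by
  have : Function.update v j (Pi.single l 1) =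
      Function.update (Function.update v j (Pi.single l 1)) i (v i) := by
    rw [eq_comm, Function.update_eq_self_iff, Function.update_of_ne hij]
  rw [this, map_update_eq_sum]
  simp [Matrix.vecMul, dotProduct, slotMatrix, Function.update_comm hij]

theorem slotMatrix_congr (f : MultilinearMap K (fun i : ι => Fin (n i) → K) K) {i j : ι}
    {v w : ∀ i, Fin (n i) → K} (h : ∀ s, s ≠ i → s ≠ j → v s = w s) :
    slotMatrix f i j v = slotMatrix f i j w := by
  ext k l
  unfold slotMatrix
  congr 1
  funext s
  by_cases hj : s = j
  · subst hj
    simp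
  by_cases hi : s = i
  · subst hi
    simp [hj]
  simp [hj, hi, h]

/-- A multilinear form of vectors with polynomial entries is a polynomial. -/
theorem exists_eval_eq_multilinear [Fintype ι] {τ : Type*}
    (f : MultilinearMap K (fun i : ι => Fin (n i) → K) K)
    (p : ∀ i, Fin (n i) → MvPolynomial τ K) :
    ∃ q : MvPolynomial τ K, ∀ w, eval w q = f fun i k ↦ eval w (p i k) := by
  refine ⟨∑ r : ∀ i, Fin (n i), (∏ i, p i (r i)) * C (f fun i ↦ Pi.single (r i) 1), fun w ↦ ?_⟩
  have : (fun i k ↦ eval w (p i k)) = fun i ↦ ∑ k, eval w (p i k) • Pi.single k (1 : K) := by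
    funext i
    exact pi_eq_sum_univ' _
  rw [this, f.map_sum]
  simp [f.map_smul_univ]

theorem exists_eval_eq_slotMatrix [Fintype ι] (f : MultilinearMap K (fun i : ι => Fin (n i) → K) K) (i j : ι) :
    ∃ P : Matrix (Fin (n i)) (Fin (n j)) (MvPolynomial (Σ i, Fin (n i)) K),
      ∀ w, P.map (eval w) = slotMatrix f i j fun i k ↦ w ⟨i, k⟩ := by
  have h (k : Fin (n i)) (l : Fin (n j)) := exists_eval_eq_multilinear f
    (Function.update (Function.update (fun s t ↦ X (⟨s, t⟩ : Σ i, Fin (n i))) i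
      (Pi.single k 1)) j (Pi.single l 1))
  choose P hP using h
  refine ⟨Matrix.of P, fun w ↦ ?_⟩
  ext k l
  simp only [Matrix.map_apply, Matrix.of_apply, hP, slotMatrix]
  congr 1
  funext s t
  by_cases hj : s = j
  · subst hj
    simp [Pi.single_apply, apply_ite (eval w)]
  by_cases hi : s = i
  · subst hi
    simp [hj, Pi.single_apply, apply_ite (eval w)]
  simp [hj, hi]

theorem pointDim_degenerateLocus_le [Fintype ι] (f : MultilinearMap K (fun i : ι => Fin (n i) → K) K)
    {i j : ι} (hij : i ≠ j) :
    pointDim (degenerateLocus f i) ≤ pointDim (degenerateLocus f j) := by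
  obtain ⟨P, hP⟩ := exists_eval_eq_slotMatrix f i j
  let A (w : (Σ i, Fin (n i)) → K) := slotMatrix f i j fun i k ↦ w ⟨i, k⟩
  -- The bound on the size of the minor makes this index type finite, as the union bound requires.
  let κ := Σ r : Fin (Fintype.card (Fin (n j)) + 1),
    (Fin (r : ℕ) → Fin (n i)) × (Fin (r : ℕ) → Fin (n j))
  let S (c : κ) : Set ((Σ i, Fin (n i)) → K) := {w | w ∈ degenerateLocus f i ∧
    ((A w).submatrix c.2.1 c.2.2).det ≠ 0 ∧
    ∀ x : Fin (n i) → K, x ᵥ* (A w).submatrix id c.2.2 = 0 → x ᵥ* A w = 0}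
  have hcover : degenerateLocus f i ⊆ ⋃ c, S c := by
    intro w hw
    obtain ⟨r, hr, I, J, h⟩ := exists_submatrix_det_ne_zero (A w)
    exact Set.mem_iUnion.mpr ⟨⟨⟨r, hr⟩, I, J⟩, hw, h⟩
  refine (pointDim_mono hcover).trans (pointDim_iUnion_le fun ⟨r, I, J⟩ ↦ ?_)
  let R := MvPolynomial (Σ i, Fin (n i)) K
  let Y : Fin (n j) → R := fun l ↦ X ⟨j, l⟩
  -- The exchange map with the entries of `A` replaced by polynomials in the coordinates. Its image
  -- may leave `degenerateLocus f i`; only that it covers the piece matters.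
  let φ : ∀ s, Fin (n s) → R := Function.update (Function.update (fun s t ↦ X ⟨s, t⟩) i
      ((fun k ↦ X ⟨i, k⟩) + (1 : Matrix _ _ R).submatrix id I *ᵥ (P.submatrix I id *ᵥ Y))) j
      ((P.submatrix I J).det • Y - (1 : Matrix _ _ R).submatrix id J *ᵥ
        ((P.submatrix I J).adjugate *ᵥ (P.submatrix I id *ᵥ Y)))
  refine (pointDim_mono ?_).trans (pointDim_image_le (fun s ↦ φ s.1 s.2) (degenerateLocus f j))
  rintro w ⟨hw, hdet, hJ⟩
  let v : ∀ i, Fin (n i) → K := fun i k ↦ w ⟨i, k⟩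
  obtain ⟨x, y', hx, hx', hy⟩ := exists_kernel_exchange (A w) I J hdet hJ (v i) (v j) (by
    funext k
    exact (slotMatrix_mulVec f hij v k).trans (hw k))
  let v' := Function.update (Function.update v i x) j y'
  let w' : (Σ i, Fin (n i)) → K := fun s ↦ v' s.1 s.2
  -- Only slots `i` and `j` change, and the matrix does not depend on them.
  have hA : A w' = A w := slotMatrix_congr f fun s hi hj ↦ by simp [w', v', v, hi, hj]
  have hPw : P.map (eval w') = A w := (hP w').trans hA
  have hv'j : v' j = y' := by simp [v']
  have hv'i : v' i = x := by simp [v', hij]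
  refine ⟨w', fun l ↦ ?_, ?_⟩
  · have := vecMul_slotMatrix f hij v' l
    rw [show slotMatrix f i j v' = A w from hA, hv'i, hx] at this
    exact this.symm
  · have hY : eval w' ∘ Y = y' := by
      funext l
      simpa [Y, w'] using congrFun hv'j l
    have h1 : eval w' ∘ (P.submatrix I id *ᵥ Y) = (A w).submatrix I id *ᵥ y' := by
      rw [← hY, ← hPw]
      funext k
      exact RingHom.map_mulVec _ _ _ _
    have hone {N r : ℕ} (J : Fin r → Fin N) : ((1 : Matrix (Fin N) _ R).submatrix id J).map (eval w') =
        (1 : Matrix (Fin N) _ K).submatrix id J := by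
      rw [← Matrix.submatrix_map, Matrix.map_one _ (map_zero _) (map_one _)]
    funext ⟨s, t⟩
    by_cases hsj : s = j
    · subst hsj
      have h2 : eval w' (P.submatrix I J).det = ((A w).submatrix I J).det := by
        rw [RingHom.map_det, ← hPw]
        rfl
      have h3 : (P.submatrix I J).adjugate.map (eval w') = ((A w).submatrix I J).adjugate := by
        rw [← hPw]
        exact RingHom.map_adjugate _ _
      have h4 : eval w' ∘ ((P.submatrix I J).adjugate *ᵥ (P.submatrix I id *ᵥ Y)) =
          ((A w).submatrix I J).adjugate *ᵥ ((A w).submatrix I id *ᵥ y') := by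
        rw [← h1, ← h3]
        funext k
        exact RingHom.map_mulVec _ _ _ _
      have := congrFun hy t
      rw [show w ⟨s, t⟩ = v s t from rfl, this]
      simp only [φ, Function.update_self, Pi.sub_apply, Pi.smul_apply, smul_eq_mul, map_sub,
        map_mul, h2]
      rw [RingHom.map_mulVec, h4, hone, ← hY]
      rfl
    by_cases hsi : s = i
    · subst hsi
      have := congrFun hx' t
      rw [show w ⟨s, t⟩ = v s t from rfl, this]
      simp only [φ, Function.update_of_ne hsj, Function.update_self, Pi.add_apply, map_add]
      rw [RingHom.map_mulVec, h1, hone, ← hv'i]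
      simp [w']
    · simp [φ, hsj, hsi, w', v', v]

end Slots

/-! ### Codimension after adding free coordinates. -/

section Codimension

theorem codim_eq_of_dim_add {L L' σ σ' : Type*} [Field L] [Field L'] [Fintype σ] [Fintype σ']
    {Z : Set (σ → L)} {Z' : Set (σ' → L')} {a b : ℕ}
    (hcard : Fintype.card σ + a = Fintype.card σ' + b) (hdim : dim Z + a = dim Z' + b) :
    codim Z = codim Z' := by
  unfold codim
  generalize dim Z = x at *
  generalize dim Z' = y at *
  cases x with
  | bot =>
    cases y with
    | bot => rfl
    | coe y => exact absurd hdim.symm (by simp)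
  | coe x =>
    cases y with
    | bot => exact absurd hdim (by simp)
    | coe y =>
      have hxy : x + a = y + b := by exact_mod_cast hdim
      change (Fintype.card σ : ℕ∞) - x = Fintype.card σ' - y
      cases x with
      | top => cases y with
        | top => simp
        | coe y => exact absurd hxy (ENat.natCast_ne_top (y + b)).symm
      | coe x => cases y with
        | top => exact absurd hxy (ENat.natCast_ne_top (x + a))
        | coe y =>
          norm_cast at hxy ⊢
          omega

end Codimension

/-! ### From slices to degenerate loci. -/

section Slices

theorem pointDim_reindex {K σ τ : Type*} [Field K] [Finite σ] [Finite τ] (e : σ ≃ τ)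
    (S : Set (τ → K)) : pointDim {x : σ → K | x ∘ e.symm ∈ S} = pointDim S := by
  apply le_antisymm
  · refine (pointDim_mono ?_).trans (pointDim_image_le (fun i ↦ X (e i)) S)
    exact fun x hx ↦ ⟨x ∘ e.symm, hx, by simp⟩
  · refine (pointDim_mono ?_).trans (pointDim_image_le (fun i ↦ X (e.symm i)) _)
    exact fun x hx ↦ ⟨x ∘ e, by simpa [Function.comp_assoc] using hx, by simp⟩

variable {K : Type*} [Field K] {d : ℕ} {n : Fin (d + 1) → ℕ}

/-- The coordinates of a product of spaces are those of slot `j` and those of the other slots. -/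
noncomputable def slotEquiv (n : Fin (d + 1) → ℕ) (j : Fin (d + 1)) :
    Fin (n j) ⊕ (Σ i : Fin d, Fin (n (j.succAbove i))) ≃ Σ i, Fin (n i) :=
  Equiv.ofBijective (Sum.elim (fun k ↦ ⟨j, k⟩) fun s ↦ ⟨j.succAbove s.1, s.2⟩) <| by
    constructor
    · rintro (k | ⟨i, k⟩) (l | ⟨i', l⟩) h
      · simpa using h
      · exact absurd (congrArg Sigma.fst h) (j.succAbove_ne i').symm
      · exact absurd (congrArg Sigma.fst h) (j.succAbove_ne i)
      · obtain rfl : i = i' := Fin.succAbove_right_injective (congrArg Sigma.fst h)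
        simpa using h
    · rintro ⟨i, k⟩
      rcases Fin.eq_self_or_eq_succAbove j i with rfl | ⟨i, rfl⟩
      · exact ⟨Sum.inl k, rfl⟩
      · exact ⟨Sum.inr ⟨i, k⟩, rfl⟩

theorem card_add_slot (n : Fin (d + 1) → ℕ) (j : Fin (d + 1)) :
    Fintype.card (Σ i : Fin d, Fin (n (j.succAbove i))) + n j =
      Fintype.card (Σ i, Fin (n i)) := by
  rw [← Fintype.card_congr (slotEquiv n j), Fintype.card_sum, Fintype.card_fin, add_comm]

/-- Inserting a free slot `j` turns the rational points of the slice into the degenerate locus. -/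
theorem pointDim_degenerateLocus [Infinite K]
    (f : MultilinearMap K (fun i : Fin (d + 1) => Fin (n i) → K) K) (j : Fin (d + 1)) :
    pointDim (degenerateLocus f j) = pointDim (rationalPoints (slice f j)) + n j := by
  have h := pointDim_prod_univ (τ := Fin (n j)) (rationalPoints (slice f j))
  rw [Nat.card_fin] at h
  rw [← h, ← pointDim_reindex (slotEquiv n j)]
  congr 1
  ext x
  have hins (k : Fin (n j)) : slice f j (fun i l ↦ x (Sum.inr ⟨i, l⟩)) k =
      f (Function.update (fun i l ↦ (x ∘ (slotEquiv n j).symm) ⟨i, l⟩) j (Pi.single k 1)) := by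
    rw [← Fin.insertNth_removeNth]
    change f (j.insertNth _ _) = _
    congr 2
    funext i l
    exact congrArg x ((slotEquiv n j).symm_apply_apply (Sum.inr ⟨i, l⟩)).symm
  simp only [degenerateLocus, rationalPoints, Set.mem_ofPred_eq, ← hins]
  exact funext_iff.symm

end Slices

end MultilinearVariety

theorem mainTheorem10 {K : Type*} [Field K] [Infinite K] {d : ℕ} {n : Fin (d + 1) → ℕ}
    (f : MultilinearMap K (fun i : Fin (d + 1) => Fin (n i) → K) K) (j : Fin (d + 1)) :
    MultilinearVariety.analyticRank f =
      MultilinearVariety.codim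
        (MultilinearVariety.zariskiClosure
          (MultilinearVariety.rationalPoints (MultilinearVariety.slice f j))) := by
  open MultilinearVariety in
  unfold analyticRank
  refine codim_eq_of_dim_add (a := n (Fin.last d)) (b := n j)
    ((card_add_slot n _).trans (card_add_slot n j).symm) ?_
  rw [dim_zariskiClosure, dim_zariskiClosure, ← pointDim_degenerateLocus,
    ← pointDim_degenerateLocus]
  by_cases h : Fin.last d = j
  · rw [h]
  · exact le_antisymm (pointDim_degenerateLocus_le f h) (pointDim_degenerateLocus_le f (Ne.symm h))
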